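/- Let $\lambda_t>0$, $p\in[0,1]$, $N\in\mathbb N$, $C_d,C_r,d_0>0$ and $\alpha>2$. Transmitters (TXs) are located at the points $T_k\in\mathbb R^2$ of a homogeneous Poisson point process $\Lambda_t$ of density $\lambda_t$. Independently for each TX, with probability $p$ it has an assisting reconfigurable intelligent surface (RIS) with $N$ elements, located uniformly at random on the circle of radius $d_0$ around $T_k$; write $b_k=1$ in that case and $b_k=0$ otherwise. (TXs and RISs thus form a Gauss–Poisson process.) The typical user is at the origin; $d_{g,k}=\|T_k\|$ is its distance from the TX $k$ and $\eta_{g,k}=C_d d_{g,k}^{-\alpha}$ the path loss of the direct link. Under the distance approximation, the distance from the RIS of the TX $k$ to the user is replaced by $d_{g,k}$, so that the path loss of the reflected link is $\eta_{h,k}=C_r(d_0d_{g,k})^{-\alpha}$. The power received by the user from the TX $k$ is $$I_k=b_k\left|\sqrt{\eta_{g,k}}\,g_k+\sqrt{\eta_{h,k}}\,I_{r,k}\right|^2+(1-b_k)\left|\sqrt{\eta_{g,k}}\,g_k\right|^2 ,$$ where the direct fading coefficient $g_k$ has the law $\mathcal{CN}(0,1)$ and, by the central limit approximation, the aggregate reflected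 coefficient $I_{r,k}$ of the $N$ elements has the law $\mathcal{CN}(0,N)$; hence, given the locations and the $b_k$, the power $I_k$ is exponentially distributed with mean $\eta_{g,k}+N\eta_{h,k}$ if $b_k=1$ and with mean $\eta_{g,k}$ if $b_k=0$. All $b_k$, RIS directions, $g_k$ and $I_{r,k}$ are independent of each other and of $\Lambda_t$. Then $\sum_k I_k<\infty$ almost surely. Moreover, with fixed association, i.e. if the user is served by a TX at a fixed location $x$, the aggregate interference power $I$, the sum of the $I_k$ over all TXs other than the serving one, has for every $s\ge 0$ the Laplace transform $$\mathcal L_{I,f}(s)=\mathbb E\left[e^{-sI}\right]=E_{f,1}(s)\,E_{f,2}(s),$$ $$E_{f,1}(s)=\exp\left(-\frac{2\pi^2\lambda_t\,p\,\csc(2\pi/\alpha)\,(e_1s)^{2/\alpha}}{\alpha}\right),\qquad E_{f,2}(s)=\exp\left(-\frac{2\pi^2\lambda_t\,(1-p)\,\csc(2\pi/\alpha)\,(C_ds)^{2/\alpha}}{\alpha}\right),$$ with $e_1=C_d+N\,C_r\,d_0^{-\alpha}$. This holds in both readings of fixed association. (i) The serving TX is a point of $\Lambda_t$ and the expectation is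 conditional on $\Lambda_t$ having a point at $x$ (Palm expectation): for every Borel set $B\subseteq\mathbb R^2$, $$\mathbb E\sum_{k:\,T_k\in B}\exp\left(-s\sum_{j\ne k}I_j\right)=\lambda_t\int_B E_{f,1}(s)E_{f,2}(s)\,dx .$$ (ii) The serving TX is placed at a fixed location in addition to the points of $\Lambda_t$: $\mathbb E\left[\exp\left(-s\sum_k I_k\right)\right]=E_{f,1}(s)E_{f,2}(s)$. -/

import Mathlib

open MeasureTheory ProbabilityTheory
open scoped ENNReal NNReal

noncomputable section

/-- The plane in which the transmitters (TXs), the reconfigurable intelligent surfaces (RISs) and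
the typical user live; the typical user is at the origin. -/
abbrev Plane : Type := EuclideanSpace ℝ (Fin 2)

/-- The circularly symmetric complex Gaussian law `CN(0, v)`: real and imaginary part are
independent centred Gaussians of variance `v / 2`. -/
def complexGaussian (v : ℝ≥0) : Measure ℂ :=
  ((gaussianReal 0 (v / 2)).prod (gaussianReal 0 (v / 2))).map
    (fun z : ℝ × ℝ => (⟨z.1, z.2⟩ : ℂ))

/-- The number of indices `k` for which the point `X k` lies in `B`. -/
def pointCount {Ω : Type*} (X : ℕ → Ω → Plane) (B : Set Plane) (ω : Ω) : ℕ∞ :=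
  {k : ℕ | X k ω ∈ B}.encard

/-- The points `X 0, X 1, …` form a homogeneous Poisson point process of density `lam` in the plane:
the number of points in a Borel set of finite area is Poisson distributed with mean `lam` times the
area, and the numbers of points in disjoint sets are independent. -/
structure IsHPPP {Ω : Type*} [MeasurableSpace Ω] (P : Measure Ω) (lam : ℝ≥0)
    (X : ℕ → Ω → Plane) : Prop where
  measurable : ∀ k, Measurable (X k)
  law_count : ∀ B : Set Plane, MeasurableSet B → volume B ≠ ∞ →
    HasLaw (pointCount X B)
      ((poissonMeasure (lam * (volume B).toNNReal)).map (Nat.cast : ℕ → ℕ∞)) P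
  indep_count : ∀ (n : ℕ) (B : Fin n → Set Plane), (∀ i, MeasurableSet (B i)) →
    (∀ i, volume (B i) ≠ ∞) → Pairwise (fun i j => Disjoint (B i) (B j)) →
    iIndepFun (fun i => pointCount X (B i)) P

/-- What is attached to one TX: whether it has an assisting RIS; the direction in which that RIS is
seen from the TX; the small scale fading coefficient `g` of the direct TX-user link; the aggregate
small scale coefficient of the reflected TX-RIS-user links. -/
abbrev Mark : Type := Bool × ℝ × ℂ × ℂ

/-- The law of a mark. Its four components are independent: there is an assisting RIS with
probability `p`, its direction is uniform on `[-π, π)`, the direct fading coefficient is `CN(0, 1)`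
(Rayleigh fading of unit mean power), and the aggregate reflected coefficient of the `N` elements
has the law `CN(0, N)`, its central limit approximation. -/
def markLaw (p : unitInterval) (N : ℕ) : Measure Mark :=
  (bernoulliMeasure true false p).prod
    ((cond volume (Set.Ico (-Real.pi) Real.pi)).prod
      ((complexGaussian 1).prod (complexGaussian (N : ℝ≥0))))

/-- A random network of TXs and RISs located according to a Gauss-Poisson process, with its fading
coefficients. The TX locations `tx k` (the parent points) form a homogeneous Poisson point process
of density `lam`; the marks are independent and identically distributed, and independent of the TX
locations. -/
structure RISNetwork {Ω : Type*} [MeasurableSpace Ω] (P : Measure Ω) (lam : ℝ≥0)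
    (p : unitInterval) (N : ℕ) where
  tx : ℕ → Ω → Plane
  mark : ℕ → Ω → Mark
  isHPPP_tx : IsHPPP P lam tx
  measurable_mark : ∀ k, Measurable (mark k)
  law_mark : ∀ k, HasLaw (mark k) (markLaw p N) P
  iIndepFun_mark : iIndepFun mark P
  indepFun_tx_mark : IndepFun (fun ω k => tx k ω) (fun ω k => mark k ω) P

/-- Path loss `C_d d ^ (-α)` of a direct link of length `d`. -/
def directPathLoss (Cd α d : ℝ) : ℝ := Cd * d ^ (-α)

/-- Path loss `C_r (d₀ d) ^ (-α)` of a reflected path: the TX-RIS distance is `d₀`, and the RIS-user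
distance is `d`. -/
def reflectedPathLoss (Cr α d0 d : ℝ) : ℝ := Cr * (d0 * d) ^ (-α)

namespace RISNetwork

variable {Ω : Type*} [MeasurableSpace Ω] {P : Measure Ω} {lam : ℝ≥0} {p : unitInterval} {N : ℕ}

/-- Whether the TX `k` has an assisting RIS, i.e. whether its cluster has two points. -/
def hasRIS (net : RISNetwork P lam p N) (k : ℕ) (ω : Ω) : Bool := (net.mark k ω).1

/-- Direction from the TX `k` to its RIS. -/
def direction (net : RISNetwork P lam p N) (k : ℕ) (ω : Ω) : ℝ := (net.mark k ω).2.1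

/-- Direct fading coefficient of the TX `k`. -/
def directFading (net : RISNetwork P lam p N) (k : ℕ) (ω : Ω) : ℂ := (net.mark k ω).2.2.1

/-- Aggregate reflected fading coefficient of the TX `k`. -/
def reflectedFading (net : RISNetwork P lam p N) (k : ℕ) (ω : Ω) : ℂ := (net.mark k ω).2.2.2

/-- Location of the RIS of the TX `k` (the daughter point): uniform on the circle of radius `d0`
around the TX. -/
def ris (net : RISNetwork P lam p N) (d0 : ℝ) (k : ℕ) (ω : Ω) : Plane :=
  net.tx k ω + d0 • !₂[Real.cos (net.direction k ω), Real.sin (net.direction k ω)]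

/-- The Gauss-Poisson process: all the TXs, and the RISs of those TXs that have one. -/
def gaussPoisson (net : RISNetwork P lam p N) (d0 : ℝ) (ω : Ω) : Set Plane :=
  {x | ∃ k, x = net.tx k ω ∨ (net.hasRIS k ω = true ∧ x = net.ris d0 k ω)}

/-- Distance from the TX `k` to the user at the origin. -/
def distTX (net : RISNetwork P lam p N) (k : ℕ) (ω : Ω) : ℝ := ‖net.tx k ω‖

/-- Distance from the RIS of the TX `k` to the user at the origin. -/
def distRIS (net : RISNetwork P lam p N) (d0 : ℝ) (k : ℕ) (ω : Ω) : ℝ := ‖net.ris d0 k ω‖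

/-- The power received by the user from the TX `k`, where `dr k` is used as the RIS-user distance:
`|√η_g g + √η_h J|²` if the TX has an assisting RIS, and `|√η_g g|²` if it has none, with the path
losses `η_g`, `η_h` and the fading coefficients `g`, `J` of the direct and of the reflected link. -/
def powerWith (net : RISNetwork P lam p N) (Cd Cr d0 α : ℝ) (dr : ℕ → Ω → ℝ) (k : ℕ) (ω : Ω) : ℝ :=
  if net.hasRIS k ω = true then
    ‖((Real.sqrt (directPathLoss Cd α (net.distTX k ω)) : ℝ) : ℂ) * net.directFading k ω
      + ((Real.sqrt (reflectedPathLoss Cr α d0 (dr k ω)) : ℝ) : ℂ) * net.reflectedFading k ω‖ ^ 2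
  else
    ‖((Real.sqrt (directPathLoss Cd α (net.distTX k ω)) : ℝ) : ℂ) * net.directFading k ω‖ ^ 2

/-- The received power before the distance approximation: the RIS-user distance is the true one. -/
def unapproximatedPower (net : RISNetwork P lam p N) (Cd Cr d0 α : ℝ) (k : ℕ) (ω : Ω) : ℝ :=
  net.powerWith Cd Cr d0 α (net.distRIS d0) k ω

/-- The received power under the distance approximation: the RIS-user distance is replaced by the
TX-user distance. -/
def power (net : RISNetwork P lam p N) (Cd Cr d0 α : ℝ) (k : ℕ) (ω : Ω) : ℝ :=
  net.powerWith Cd Cr d0 α net.distTX k ω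

/-- The aggregate interference power under the distance approximation: the sum of the powers of all
the TXs of the network that do not serve the user. Here `serving = some k` means that the TX `k` of
the network serves the user, and `serving = none` that the user is served by a further TX, which
does not belong to the network. -/
def interference (net : RISNetwork P lam p N) (Cd Cr d0 α : ℝ) (serving : Option ℕ) (ω : Ω) : ℝ :=
  ∑' k, if serving = some k then 0 else net.power Cd Cr d0 α k ω

/-- `f x` is the conditional expectation of `F k`, given that there is a TX at the location `x` and
that `k` is the index of this TX. Conditioning a stationary point process of density `lam` on an
atom at `x` is meant in the sense of Palm: `𝔼 ∑_{k : tx k ∈ B} F k = lam ∫_B f(x) dx` for all Borel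
sets `B`. -/
def IsPalmExpectation (net : RISNetwork P lam p N) (F : ℕ → Ω → ℝ≥0∞) (f : Plane → ℝ≥0∞) : Prop :=
  Measurable f ∧ ∀ B : Set Plane, MeasurableSet B →
    ∫⁻ ω, ∑' k, B.indicator (fun _ => F k ω) (net.tx k ω) ∂P = (lam : ℝ≥0∞) * ∫⁻ x in B, f x

end RISNetwork

/-- The constant `e₁ = C_d + N C_r d₀ ^ (-α)`. -/
def e1 (N : ℕ) (Cd Cr d0 α : ℝ) : ℝ := Cd + N * Cr * d0 ^ (-α)

/-- `exp (-(2 π² lam q csc (2 π / α) (c s) ^ (2 / α)) / α)`. -/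
def laplaceFactor (lam q c α s : ℝ) : ℝ :=
  Real.exp (-(2 * Real.pi ^ 2 * lam * q * (Real.sin (2 * Real.pi / α))⁻¹ * (c * s) ^ (2 / α)) / α)

end

section

open Filter Topology Set

noncomputable section

/-! ### The function `x ↦ exp (-x)` on `[0, ∞]` -/

/-! Exponential functionals are computed with values in `[0, ∞]`, where sums over all points always
exist; almost sure finiteness of the interference is then a consequence and not a prerequisite.

Given the locations, the marks are i.i.d., so averaging over them turns `exp (-s ∑ I_k)` into the
product of `markLaplace` over the points (`lintegral_mul_expNeg_tsum_mark`). This is again an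
exponential functional of the points alone, with `f = negLog markLaplace`, and the Laplace
functional of the Poisson process (`IsHPPP.lintegral_expNeg_tsum`) evaluates it as `exp (-lam ∫ (1 -
markLaplace))`.

A linear combination of independent complex Gaussians has exponential power, so `markLaplace` at `x`
is the mixture, with weights `p` and `1 - p`, of `1 / (1 + s c ‖x‖ ^ (-α))` for `c = e1` and `c =
Cd`. Each term contributes the integral of `c s / (‖x‖ ^ α + c s)` over the plane, which the
reflection formula for the Gamma function evaluates (`lintegral_div_norm_rpow_add`); the two
contributions to the exponent give the two factors.

For a serving transmitter of the network, differentiating the Laplace functional at `f` in a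
suitable direction shows that removing the conditioned point leaves the same expectation
(`IsHPPP.lintegral_tsum_expNeg`). Summability follows on letting `s → 0` in the transform. -/

/-- The function `x ↦ exp (-x)` on `[0, ∞]`, with `exp (-∞) = 0`. -/
def expNeg (x : ℝ≥0∞) : ℝ≥0∞ := EReal.exp (-(x : EReal))

@[simp] lemma expNeg_zero : expNeg 0 = 1 := by simp [expNeg]

@[simp] lemma expNeg_top : expNeg ∞ = 0 := by simp [expNeg]

lemma expNeg_coe (x : ℝ≥0) : expNeg x = ENNReal.ofReal (Real.exp (-x)) := by
  rw [expNeg, EReal.coe_nnreal_eq_coe_real, ← EReal.coe_neg, EReal.exp_coe]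

lemma expNeg_ofReal {x : ℝ} (hx : 0 ≤ x) :
    expNeg (ENNReal.ofReal x) = ENNReal.ofReal (Real.exp (-x)) := by
  lift x to ℝ≥0 using hx
  rw [ENNReal.ofReal_coe_nnreal, expNeg_coe]

lemma expNeg_add (x y : ℝ≥0∞) : expNeg (x + y) = expNeg x * expNeg y := by
  induction x with
  | top => simp
  | coe x =>
    induction y with
    | top => simp
    | coe y =>
      rw [← ENNReal.coe_add, expNeg_coe, expNeg_coe, expNeg_coe,
        ← ENNReal.ofReal_mul (Real.exp_nonneg _), ← Real.exp_add]
      push_cast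
      rw [neg_add]

lemma continuous_expNeg : Continuous expNeg :=
  ENNReal.continuous_exp.comp (continuous_neg.comp continuous_coe_ennreal_ereal)

@[fun_prop]
lemma measurable_expNeg : Measurable expNeg := continuous_expNeg.measurable

lemma antitone_expNeg : Antitone expNeg := fun _ _ h =>
  EReal.exp_monotone (EReal.neg_le_neg_iff.2 (EReal.coe_ennreal_le_coe_ennreal_iff.2 h))

lemma expNeg_le_one (x : ℝ≥0∞) : expNeg x ≤ 1 := by
  simpa using antitone_expNeg (zero_le (a := x))

lemma expNeg_ne_top (x : ℝ≥0∞) : expNeg x ≠ ∞ :=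
  ((expNeg_le_one x).trans_lt ENNReal.one_lt_top).ne

lemma expNeg_sum {ι : Type*} (s : Finset ι) (f : ι → ℝ≥0∞) :
    expNeg (∑ i ∈ s, f i) = ∏ i ∈ s, expNeg (f i) := by
  classical
  induction s using Finset.induction_on with
  | empty => simp
  | insert i s hi ih => rw [Finset.sum_insert hi, Finset.prod_insert hi, expNeg_add, ih]

lemma expNeg_mul_natCast (x : ℝ≥0∞) (n : ℕ) : expNeg (x * n) = expNeg x ^ n := by
  induction n with
  | zero => simp
  | succ n ih => rw [Nat.cast_succ, mul_add, mul_one, expNeg_add, ih, pow_succ]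

/-- Reduces infinitely many factors to finite products, to which independence applies; a divergent
sum is allowed and gives the limit `0`. -/
lemma tendsto_prod_expNeg (f : ℕ → ℝ≥0∞) :
    Tendsto (fun n => ∏ i ∈ Finset.range n, expNeg (f i)) atTop (𝓝 (expNeg (∑' i, f i))) := by
  simp_rw [← expNeg_sum]
  exact (continuous_expNeg.tendsto _).comp (ENNReal.tendsto_nat_tsum f)

/-- The inverse of `expNeg` on `[0, 1]`. -/
def negLog (y : ℝ≥0∞) : ℝ≥0∞ := (-ENNReal.log y).toENNReal

/-- For `y ≤ 1` the number `-log y` is nonnegative, so the truncation in `toENNReal` loses nothing.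
-/
lemma expNeg_negLog {y : ℝ≥0∞} (hy : y ≤ 1) : expNeg (negLog y) = y := by
  have h : 0 ≤ -ENNReal.log y := by
    rw [EReal.le_neg, neg_zero]
    exact ENNReal.log_le_zero_iff.2 hy
  rw [expNeg, negLog, EReal.coe_toENNReal h, neg_neg, ENNReal.exp_log]

@[fun_prop]
lemma measurable_negLog : Measurable negLog := by
  unfold negLog
  exact (ENNReal.measurable_log.neg).ereal_toENNReal

lemma negLog_ne_top {y : ℝ≥0∞} (hy : y ≤ 1) (h0 : y ≠ 0) : negLog y ≠ ∞ := by
  intro h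
  apply h0
  rw [← expNeg_negLog hy, h, expNeg_top]

lemma expNeg_ne_zero {x : ℝ≥0∞} (hx : x ≠ ∞) : expNeg x ≠ 0 := by
  lift x to ℝ≥0 using hx
  rw [expNeg_coe]
  simp [Real.exp_pos]

/-! ### The difference quotient of `expNeg` at zero -/

lemma one_sub_expNeg_le (x : ℝ≥0∞) : 1 - expNeg x ≤ x := by
  induction x with
  | top => simp
  | coe x =>
    rw [expNeg_coe, ← ENNReal.ofReal_one, ← ENNReal.ofReal_sub _ (Real.exp_nonneg _),
      ← ENNReal.ofReal_coe_nnreal]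
    exact ENNReal.ofReal_le_ofReal (by linarith [Real.add_one_le_exp (-(x : ℝ))])

/-- Slopes of `u ↦ 1 - expNeg (u * x)` at zero. -/
def slopeExpNeg (n : ℕ) (x : ℝ≥0∞) : ℝ≥0∞ := (n : ℝ≥0∞) * (1 - expNeg (x / n))

@[fun_prop]
lemma measurable_slopeExpNeg (n : ℕ) : Measurable (slopeExpNeg n) := by
  unfold slopeExpNeg
  fun_prop

lemma slopeExpNeg_le (n : ℕ) (x : ℝ≥0∞) : slopeExpNeg n x ≤ x := by
  rcases eq_or_ne n 0 with rfl | hn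
  · simp [slopeExpNeg]
  calc slopeExpNeg n x ≤ n * (x / n) := by
        unfold slopeExpNeg; gcongr; exact one_sub_expNeg_le _
    _ = x := ENNReal.mul_div_cancel (by simpa using hn) (by simp)

lemma tendsto_mul_one_sub_exp_neg_div {x : ℕ → ℝ} {c : ℝ} (hx : Tendsto x atTop (𝓝 c)) :
    Tendsto (fun n : ℕ => (n : ℝ) * (1 - Real.exp (-(x n / n)))) atTop (𝓝 c) := by
  have h0 : Tendsto (fun n : ℕ => -(x n / n)) atTop (𝓝 0) := by
    simpa using (hx.div_atTop tendsto_natCast_atTop_atTop).neg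
  have hs : Tendsto (fun y : ℝ => dslope Real.exp 0 y) (𝓝 0) (𝓝 1) := by
    have := (continuousAt_dslope_same.2 (Real.differentiableAt_exp (x := 0))).tendsto
    simpa [dslope_same] using this
  have h1 : Tendsto (fun n : ℕ => dslope Real.exp 0 (-(x n / n)) * x n) atTop (𝓝 (1 * c)) :=
    (hs.comp h0).mul hx
  rw [one_mul] at h1
  refine h1.congr' ?_
  filter_upwards [eventually_gt_atTop 0] with n hn
  have hn' : (n : ℝ) ≠ 0 := by positivity
  have h2 := sub_smul_dslope Real.exp 0 (-(x n / n))
  simp only [sub_zero, smul_eq_mul, Real.exp_zero] at h2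
  have h3 : 1 - Real.exp (-(x n / n)) = (x n / n) * dslope Real.exp 0 (-(x n / n)) := by linarith
  rw [h3]
  field_simp

/-- The derivative of `exp` at zero is `1`. The argument may vary with `n`, as it does on the
right-hand side of the differentiated Laplace functional. -/
lemma tendsto_slopeExpNeg_of_tendsto {x : ℕ → ℝ≥0∞} {c : ℝ≥0∞} (hc : c ≠ ∞)
    (hx : Tendsto x atTop (𝓝 c)) : Tendsto (fun n => slopeExpNeg n (x n)) atTop (𝓝 c) := by
  have hr := tendsto_mul_one_sub_exp_neg_div ((ENNReal.tendsto_toReal hc).comp hx)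
  have := (ENNReal.continuous_ofReal.tendsto _).comp hr
  rw [ENNReal.ofReal_toReal hc] at this
  refine this.congr' ?_
  filter_upwards [hx.eventually_lt_const (lt_top_iff_ne_top.2 hc), eventually_gt_atTop 0]
    with n hn hn0
  simp only [Function.comp_apply, slopeExpNeg]
  rw [ENNReal.ofReal_mul (by positivity), ENNReal.ofReal_natCast,
    ENNReal.ofReal_sub _ (Real.exp_nonneg _), ENNReal.ofReal_one, ← expNeg_ofReal (by positivity),
    ENNReal.ofReal_div_of_pos (by positivity), ENNReal.ofReal_toReal hn.ne,
    ENNReal.ofReal_natCast]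

lemma tendsto_slopeExpNeg (x : ℝ≥0∞) : Tendsto (fun n => slopeExpNeg n x) atTop (𝓝 x) := by
  rcases eq_or_ne x ∞ with rfl | hx
  · refine ENNReal.tendsto_nat_nhds_top.congr' ?_
    filter_upwards with n
    simp [slopeExpNeg, ENNReal.top_div_of_ne_top]
  · exact tendsto_slopeExpNeg_of_tendsto hx tendsto_const_nhds

/-- Convergence of integrals of functions which converge to an upper bound. -/
lemma tendsto_lintegral_of_tendsto_of_le {α : Type*} [MeasurableSpace α] {μ : Measure α}
    {F : ℕ → α → ℝ≥0∞} {f : α → ℝ≥0∞} (hF : ∀ n, Measurable (F n)) (hle : ∀ n x, F n x ≤ f x)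
    (hlim : ∀ x, Tendsto (fun n => F n x) atTop (𝓝 (f x))) :
    Tendsto (fun n => ∫⁻ x, F n x ∂μ) atTop (𝓝 (∫⁻ x, f x ∂μ)) := by
  -- Fatou's lemma gives the lower bound and `hle` the upper one; `f` need not be integrable, nor
  -- `F` monotone in `n`.
  refine tendsto_of_le_liminf_of_limsup_le ?_ ?_
  · calc ∫⁻ x, f x ∂μ = ∫⁻ x, liminf (fun n => F n x) atTop ∂μ := by
          simp_rw [(hlim _).liminf_eq]
      _ ≤ _ := lintegral_liminf_le hF
  · exact limsup_le_of_le (h := Eventually.of_forall fun n => lintegral_mono (hle n))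

/-! ### Laplace functional and reduced Campbell formula of a Poisson point process -/

lemma lintegral_pow_poissonMeasure (m : ℝ≥0) {t : ℝ≥0∞} (ht : t ≤ 1) :
    ∫⁻ n, t ^ n ∂(poissonMeasure m) = expNeg (m * (1 - t)) := by
  lift t to ℝ≥0 using (ht.trans_lt ENNReal.one_lt_top).ne
  have ht' : t ≤ 1 := by exact_mod_cast ht
  have hs : HasSum (fun n : ℕ => Real.exp (-m) * ((m * t : ℝ) ^ n / n.factorial))
      (Real.exp (-m) * Real.exp (m * t)) := by
    rw [Real.exp_eq_exp_ℝ]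
    exact (NormedSpace.expSeries_div_hasSum_exp (m * t : ℝ)).mul_left _
  rw [lintegral_countable']
  calc ∑' n : ℕ, (t : ℝ≥0∞) ^ n * poissonMeasure m {n}
      = ∑' n : ℕ, ENNReal.ofReal (Real.exp (-m) * ((m * t : ℝ) ^ n / n.factorial)) := by
        congr 1 with n
        rw [poissonMeasure_singleton, ← ENNReal.ofReal_coe_nnreal, ← ENNReal.ofReal_pow (by simp),
          ← ENNReal.ofReal_mul (by positivity)]
        congr 1
        rw [mul_pow]
        ring
    _ = ENNReal.ofReal (Real.exp (-m) * Real.exp (m * t)) := by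
        rw [← hs.tsum_eq, ENNReal.ofReal_tsum_of_nonneg (fun n => by positivity) hs.summable]
    _ = expNeg (m * (1 - t)) := by
        rw [← ENNReal.coe_one, ← ENNReal.coe_sub, ← ENNReal.coe_mul, expNeg_coe, ← Real.exp_add]
        congr 2
        push_cast [NNReal.coe_sub ht']
        ring

lemma toENNReal_pointCount {Ω : Type*} (X : ℕ → Ω → Plane) (B : Set Plane) (ω : Ω) :
    (pointCount X B ω : ℝ≥0∞) = ∑' k, B.indicator 1 (X k ω) := by
  rw [pointCount, ← ENNReal.tsum_set_one, tsum_subtype {k | X k ω ∈ B} (fun _ => (1 : ℝ≥0∞))]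
  rfl

/-- Groups the points by the level set they lie in. The value `0` is left out because its level set
may have infinite area, where nothing is known about the count. -/
lemma SimpleFunc.tsum_comp_eq_sum_pointCount {Ω : Type*} (X : ℕ → Ω → Plane)
    (φ : SimpleFunc Plane ℝ≥0∞) (ω : Ω) :
    ∑' k, φ (X k ω) = ∑ y ∈ φ.range.filter (· ≠ 0), y * (pointCount X (φ ⁻¹' {y}) ω : ℝ≥0∞) := by
  simp_rw [toENNReal_pointCount, ← ENNReal.tsum_mul_left]
  rw [← Summable.tsum_finsetSum (fun _ _ => ENNReal.summable)]
  congr 1 with k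
  rw [Finset.sum_filter_of_ne (p := (· ≠ 0)) (fun y _ hy h0 => hy (by simp [h0])),
    Finset.sum_eq_single (φ (X k ω))]
  · simp
  · intro y _ hy
    simp [Set.indicator_of_notMem, hy.symm]
  · intro h
    exact absurd (φ.mem_range_self _) h

section PoissonProcess

variable {Ω : Type*} [MeasurableSpace Ω] {P : Measure Ω} {lam : ℝ≥0} {X : ℕ → Ω → Plane}

lemma IsHPPP.lintegral_expNeg_mul_pointCount (hX : IsHPPP P lam X) {B : Set Plane}
    (hB : MeasurableSet B) (hfin : volume B ≠ ∞) (y : ℝ≥0∞) :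
    ∫⁻ ω, expNeg (y * pointCount X B ω) ∂P = expNeg (lam * ((1 - expNeg y) * volume B)) := by
  rw [(hX.law_count B hB hfin).lintegral_comp (f := fun n : ℕ∞ => expNeg (y * (n : ℝ≥0∞)))
    (Measurable.of_discrete.aemeasurable), lintegral_map Measurable.of_discrete
    Measurable.of_discrete]
  simp_rw [ENat.toENNReal_coe, expNeg_mul_natCast]
  rw [lintegral_pow_poissonMeasure _ (expNeg_le_one y), ENNReal.coe_mul, ENNReal.coe_toNNReal hfin,
    mul_assoc, mul_comm (volume B)]

/-- The level sets are disjoint, so their counts are independent, and the expectation is a product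
of Poisson generating functions evaluated at `expNeg y`. -/
lemma IsHPPP.lintegral_expNeg_tsum_simpleFunc (hX : IsHPPP P lam X) (φ : SimpleFunc Plane ℝ≥0∞)
    (hφ : ∀ y, y ≠ 0 → volume (φ ⁻¹' {y}) ≠ ∞) :
    ∫⁻ ω, expNeg (∑' k, φ (X k ω)) ∂P = expNeg (lam * ∫⁻ x, (1 - expNeg (φ x))) := by
  set R := φ.range.filter (· ≠ 0) with hR
  set e := R.equivFin
  set y : Fin R.card → ℝ≥0∞ := fun i => (e.symm i).1 with hy
  have hsum : ∀ g : ℝ≥0∞ → ℝ≥0∞, ∑ z ∈ R, g z = ∑ i, g (y i) := fun g => by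
    rw [← Finset.sum_coe_sort R g, ← e.symm.sum_comp]
  have hfin : ∀ i, volume (φ ⁻¹' {y i}) ≠ ∞ := fun i =>
    hφ _ (Finset.mem_filter.1 (e.symm i).2).2
  have hind : iIndepFun (fun i ω => expNeg (y i * (pointCount X (φ ⁻¹' {y i}) ω : ℝ≥0∞))) P := by
    refine (hX.indep_count _ (fun i => φ ⁻¹' {y i}) (fun i => φ.measurableSet_fiber _) hfin ?_).comp
      (fun i (n : ℕ∞) => expNeg (y i * (n : ℝ≥0∞))) (fun i => Measurable.of_discrete)
    intro i j hij
    refine Disjoint.preimage _ (Set.disjoint_singleton.2 fun h => hij ?_)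
    exact e.symm.injective (Subtype.ext h)
  have hmeas : ∀ i, Measurable fun ω => expNeg (y i * (pointCount X (φ ⁻¹' {y i}) ω : ℝ≥0∞)) := by
    intro i
    simp_rw [toENNReal_pointCount]
    have : ∀ k, Measurable fun ω => (φ ⁻¹' {y i}).indicator (1 : Plane → ℝ≥0∞) (X k ω) := fun k =>
      (measurable_one.indicator (φ.measurableSet_fiber _)).comp (hX.measurable k)
    fun_prop
  calc ∫⁻ ω, expNeg (∑' k, φ (X k ω)) ∂P
      = ∫⁻ ω, ∏ i, expNeg (y i * (pointCount X (φ ⁻¹' {y i}) ω : ℝ≥0∞)) ∂P := by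
        congr 1 with ω
        rw [SimpleFunc.tsum_comp_eq_sum_pointCount, ← hR,
          hsum (fun z => z * (pointCount X (φ ⁻¹' {z}) ω : ℝ≥0∞)), expNeg_sum]
    _ = ∏ i, expNeg (lam * ((1 - expNeg (y i)) * volume (φ ⁻¹' {y i}))) := by
        rw [lintegral_prod_eq_prod_lintegral_of_indepFun _ _ hind hmeas]
        exact Finset.prod_congr rfl fun i _ =>
          hX.lintegral_expNeg_mul_pointCount (φ.measurableSet_fiber _) (hfin i) _
    _ = expNeg (lam * ∑ z ∈ R, (1 - expNeg z) * volume (φ ⁻¹' {z})) := by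
        rw [← expNeg_sum, ← Finset.mul_sum, hsum (fun z => (1 - expNeg z) * volume (φ ⁻¹' {z}))]
    _ = expNeg (lam * ∫⁻ x, (1 - expNeg (φ x))) := by
        rw [hR, Finset.sum_filter_of_ne (p := (· ≠ 0)) (fun z _ hz h0 => hz (by simp [h0])),
          ← SimpleFunc.map_lintegral (fun z => 1 - expNeg z) φ,
          ← SimpleFunc.lintegral_eq_lintegral]
        simp

/-- The Laplace functional of a homogeneous Poisson point process. -/
theorem IsHPPP.lintegral_expNeg_tsum [IsProbabilityMeasure P] (hX : IsHPPP P lam X)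
    {f : Plane → ℝ≥0∞} (hf : Measurable f) :
    ∫⁻ ω, expNeg (∑' k, f (X k ω)) ∂P = expNeg (lam * ∫⁻ x, (1 - expNeg (f x))) := by
  -- Restricting to balls makes the level sets of nonzero values have finite area.
  set φ : ℕ → SimpleFunc Plane ℝ≥0∞ := fun n =>
    (SimpleFunc.eapprox f n).restrict (Metric.closedBall 0 n) with hφ
  have happ : ∀ n x, φ n x = (Metric.closedBall 0 (n : ℝ)).indicator (SimpleFunc.eapprox f n) x :=
    fun n x => SimpleFunc.restrict_apply _ measurableSet_closedBall _
  clear_value φ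
  have hlim : ∀ x, Tendsto (fun n => φ n x) atTop (𝓝 (f x)) := by
    intro x
    have h1 : Tendsto (fun n => SimpleFunc.eapprox f n x) atTop (𝓝 (f x)) := by
      rw [← SimpleFunc.iSup_eapprox_apply hf x]
      exact tendsto_atTop_iSup fun m n h => SimpleFunc.monotone_eapprox f h x
    refine h1.congr' ?_
    filter_upwards [eventually_ge_atTop ⌈‖x‖⌉₊] with n hn
    rw [happ, Set.indicator_of_mem]
    simpa using Nat.ceil_le.1 hn
  have hle : ∀ n x, φ n x ≤ f x := by
    intro n x
    rw [happ]
    refine (Set.indicator_le_self _ _ _).trans ?_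
    rw [← SimpleFunc.iSup_eapprox_apply hf x]
    exact le_iSup (fun n => SimpleFunc.eapprox f n x) n
  have hfin : ∀ n y, y ≠ 0 → volume (φ n ⁻¹' {y}) ≠ ∞ := by
    intro n y hy
    refine ((measure_mono ?_).trans_lt
      (measure_closedBall_lt_top (x := (0 : Plane)) (r := (n : ℝ)))).ne
    intro x hx
    by_contra hmem
    apply hy
    rw [← show φ n x = y from hx, happ, Set.indicator_of_notMem hmem]
  have hS : ∀ ω, Tendsto (fun n => ∑' k, φ n (X k ω)) atTop (𝓝 (∑' k, f (X k ω))) := by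
    intro ω
    simp_rw [← lintegral_count]
    exact tendsto_lintegral_of_tendsto_of_le (fun _ => Measurable.of_discrete)
      (fun n k => hle n _) (fun k => hlim _)
  have hmeas : ∀ n k, Measurable fun ω => φ n (X k ω) := fun n k =>
    (φ n).measurable.comp (hX.measurable k)
  have hL : Tendsto (fun n => ∫⁻ ω, expNeg (∑' k, φ n (X k ω)) ∂P) atTop
      (𝓝 (∫⁻ ω, expNeg (∑' k, f (X k ω)) ∂P)) :=
    tendsto_lintegral_of_dominated_convergence (fun _ => 1)
      (fun n => measurable_expNeg.comp (Measurable.tsum (hmeas n)))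
      (fun n => Eventually.of_forall fun ω => expNeg_le_one _) (by simp)
      (Eventually.of_forall fun ω => (continuous_expNeg.tendsto _).comp (hS ω))
  refine tendsto_nhds_unique hL ?_
  simp_rw [fun n => hX.lintegral_expNeg_tsum_simpleFunc (φ n) (hfin n)]
  refine (continuous_expNeg.tendsto _).comp (ENNReal.Tendsto.const_mul ?_ (Or.inr (by simp)))
  refine tendsto_lintegral_of_tendsto_of_le (F := fun n x => 1 - expNeg (φ n x))
    (f := fun x => 1 - expNeg (f x)) (fun n => ?_) (fun n x => ?_) (fun x => ?_)
  · have := (φ n).measurable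
    fun_prop
  · exact tsub_le_tsub_left (antitone_expNeg (hle n x)) 1
  · have h : Continuous fun y => 1 - expNeg y :=
      Continuous.comp (g := fun z : ℝ≥0∞ => 1 - z) (ENNReal.continuous_sub_left (by simp))
        continuous_expNeg
    exact (h.tendsto (f x)).comp (hlim x)

/-- The reduced Campbell formula for exponential functionals of a homogeneous Poisson point process:
the reduced Palm distributions are the distribution of the process. -/
theorem IsHPPP.lintegral_tsum_expNeg [IsProbabilityMeasure P] (hX : IsHPPP P lam X)
    {f : Plane → ℝ≥0∞} (hf : Measurable f) (hf_top : ∀ x, f x ≠ ∞) {B : Set Plane}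
    (hB : MeasurableSet B) (hfin : volume B ≠ ∞) :
    ∫⁻ ω, ∑' k, B.indicator (fun _ => expNeg (∑' j, if j = k then 0 else f (X j ω))) (X k ω) ∂P
      = lam * volume B * expNeg (lam * ∫⁻ x, (1 - expNeg (f x))) := by
  -- Multiplying the full exponential by `v (X k ω)` cancels exactly the factor of the point `k` and
  -- keeps the indicator of `B`. The sum to be computed is thus a derivative of the Laplace
  -- functional in the direction `v`.
  set v : Plane → ℝ≥0∞ := B.indicator fun x => (expNeg (f x))⁻¹ with hv
  have hvm : Measurable v := by
    refine Measurable.indicator ?_ hB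
    fun_prop
  have hXm := hX.measurable
  have hfm : ∀ k, Measurable fun ω => f (X k ω) := fun k => hf.comp (hXm k)
  have hvXm : ∀ k, Measurable fun ω => v (X k ω) := fun k => hvm.comp (hXm k)
  set A := ∫⁻ x, (1 - expNeg (f x)) with hA
  set C : ℕ → ℝ≥0∞ := fun n => ∫⁻ x, expNeg (f x) * slopeExpNeg n (v x) with hC
  have hpt : ∀ ω, expNeg (∑' k, f (X k ω)) * ∑' k, v (X k ω) = ∑' k,
      B.indicator (fun _ => expNeg (∑' j, if j = k then 0 else f (X j ω))) (X k ω) := by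
    intro ω
    rw [← ENNReal.tsum_mul_left]
    congr 1 with k
    by_cases hk : X k ω ∈ B
    · rw [hv, Set.indicator_of_mem hk, Set.indicator_of_mem hk,
        ENNReal.tsum_eq_add_tsum_ite (f := fun k => f (X k ω)) k, expNeg_add, mul_comm, ← mul_assoc,
        ENNReal.inv_mul_cancel (expNeg_ne_zero (hf_top _)) (expNeg_ne_top _), one_mul]
      congr!
    · rw [hv, Set.indicator_of_notMem hk, Set.indicator_of_notMem hk, mul_zero]
  have hC_lim : Tendsto C atTop (𝓝 (volume B)) := by
    have : ∫⁻ x, expNeg (f x) * v x = volume B := by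
      rw [← lintegral_indicator_one hB]
      congr 1 with x
      by_cases hx : x ∈ B
      · rw [hv, Set.indicator_of_mem hx, Set.indicator_of_mem hx,
          ENNReal.mul_inv_cancel (expNeg_ne_zero (hf_top _)) (expNeg_ne_top _), Pi.one_apply]
      · rw [hv, Set.indicator_of_notMem hx, Set.indicator_of_notMem hx, mul_zero]
    rw [← this]
    refine tendsto_lintegral_of_tendsto_of_le (fun n => by fun_prop) (fun n x => ?_) (fun x => ?_)
    · gcongr
      exact slopeExpNeg_le n _
    · exact ENNReal.Tendsto.const_mul (tendsto_slopeExpNeg _) (Or.inr (expNeg_ne_top _))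
  -- The difference quotient with step `1 / n`: the Laplace functional at `f` minus that at `f + v /
  -- n`, times `n`.
  have hkey : ∀ n : ℕ, n ≠ 0 →
      ∫⁻ ω, expNeg (∑' k, f (X k ω)) * slopeExpNeg n (∑' k, v (X k ω)) ∂P
        = expNeg (lam * A) * slopeExpNeg n (lam * C n) := by
    intro n hn
    have hn0 : (n : ℝ≥0∞) ≠ 0 := by simpa using hn
    have hnt : (n : ℝ≥0∞) ≠ ∞ := by simp
    have h1 : ∫⁻ ω, expNeg (∑' k, f (X k ω)) * expNeg ((∑' k, v (X k ω)) / n) ∂P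
        = expNeg (lam * A) * expNeg (lam * C n / n) := by
      have h2 := hX.lintegral_expNeg_tsum (f := fun x => f x + v x / n) (by fun_prop)
      -- Pointwise, `1 - e^(-f - v/n) = (1 - e^(-f)) + e^(-f) (1 - e^(-v/n))`.
      have h3 : ∫⁻ x, (1 - expNeg (f x + v x / n)) = A + C n / n := by
        rw [hA, hC, div_eq_mul_inv, ← lintegral_mul_const _ (by fun_prop),
          ← lintegral_add_left (by fun_prop)]
        congr 1 with x
        rw [expNeg_add, slopeExpNeg]
        have h4 : expNeg (f x) * (n * (1 - expNeg (v x / n))) * (n : ℝ≥0∞)⁻¹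
            = expNeg (f x) - expNeg (f x) * expNeg (v x / n) := by
          rw [mul_comm (n : ℝ≥0∞), ← mul_assoc, mul_assoc _ (n : ℝ≥0∞),
            ENNReal.mul_inv_cancel hn0 hnt, mul_one,
            ENNReal.mul_sub (fun _ _ => expNeg_ne_top _), mul_one]
        rw [h4, tsub_add_tsub_cancel (expNeg_le_one _)]
        exact mul_le_of_le_one_right' (expNeg_le_one _)
      rw [h3, mul_add, expNeg_add, ← mul_div_assoc] at h2
      rw [← h2]
      congr 1 with ω
      rw [ENNReal.tsum_add, expNeg_add]
      simp_rw [div_eq_mul_inv, ENNReal.tsum_mul_right]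
    simp_rw [slopeExpNeg, mul_left_comm _ (n : ℝ≥0∞), ENNReal.mul_sub (fun _ _ => expNeg_ne_top _),
      mul_one]
    rw [lintegral_const_mul _ (by fun_prop), lintegral_sub (by fun_prop), h1,
      hX.lintegral_expNeg_tsum hf]
    · rw [h1]
      exact ENNReal.mul_ne_top (expNeg_ne_top _) (expNeg_ne_top _)
    · exact Eventually.of_forall fun ω => mul_le_of_le_one_right' (expNeg_le_one _)
  have hL : Tendsto (fun n : ℕ =>
      ∫⁻ ω, expNeg (∑' k, f (X k ω)) * slopeExpNeg n (∑' k, v (X k ω)) ∂P) atTop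
      (𝓝 (∫⁻ ω, expNeg (∑' k, f (X k ω)) * ∑' k, v (X k ω) ∂P)) := by
    refine tendsto_lintegral_of_tendsto_of_le (fun n => by fun_prop) (fun n x => ?_) (fun x => ?_)
    · gcongr
      exact slopeExpNeg_le n _
    · exact ENNReal.Tendsto.const_mul (tendsto_slopeExpNeg _) (Or.inr (expNeg_ne_top _))
  have hR : Tendsto (fun n : ℕ => expNeg (lam * A) * slopeExpNeg n (lam * C n)) atTop
      (𝓝 (expNeg (lam * A) * (lam * volume B))) :=
    ENNReal.Tendsto.const_mul (tendsto_slopeExpNeg_of_tendsto (ENNReal.mul_ne_top (by simp) hfin)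
      (ENNReal.Tendsto.const_mul hC_lim (Or.inr (by simp)))) (Or.inr (expNeg_ne_top _))
  simp_rw [← hpt]
  rw [mul_comm (_ * _) (expNeg _)]
  refine tendsto_nhds_unique (hL.congr' ?_) hR
  filter_upwards [eventually_ne_atTop 0] with n hn using hkey n hn

/-- The reduced Campbell formula for Borel sets of arbitrary area. -/
theorem IsHPPP.lintegral_tsum_expNeg_of_measurableSet [IsProbabilityMeasure P] (hX : IsHPPP P lam X)
    {f : Plane → ℝ≥0∞} (hf : Measurable f) (hf_top : ∀ x, f x ≠ ∞) {B : Set Plane}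
    (hB : MeasurableSet B) :
    ∫⁻ ω, ∑' k, B.indicator (fun _ => expNeg (∑' j, if j = k then 0 else f (X j ω))) (X k ω) ∂P
      = lam * volume B * expNeg (lam * ∫⁻ x, (1 - expNeg (f x))) := by
  -- Exhaustion of `B` by sets of finite area; both sides pass to the limit.
  set D : ℕ → Set Plane := fun n => B ∩ Metric.closedBall 0 n with hD
  have hDm : ∀ n, MeasurableSet (D n) := fun n => hB.inter measurableSet_closedBall
  have hXm := hX.measurable
  have hfm : ∀ k, Measurable fun ω => f (X k ω) := fun k => hf.comp (hXm k)
  set G : ℕ → Ω → ℝ≥0∞ := fun k ω => expNeg (∑' j, if j = k then 0 else f (X j ω)) with hG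
  have hGm : ∀ k, Measurable (G k) := fun k =>
    measurable_expNeg.comp (Measurable.tsum fun j => by split_ifs <;> fun_prop)
  have hle : ∀ n k ω, (D n).indicator (fun _ => G k ω) (X k ω)
      ≤ B.indicator (fun _ => G k ω) (X k ω) := fun n k ω =>
    Set.indicator_le_indicator_of_subset Set.inter_subset_left (fun _ => zero_le) _
  have hlim : ∀ k ω, Tendsto (fun n => (D n).indicator (fun _ => G k ω) (X k ω)) atTop
      (𝓝 (B.indicator (fun _ => G k ω) (X k ω))) := by
    intro k ω
    refine tendsto_const_nhds.congr' ?_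
    filter_upwards [eventually_ge_atTop ⌈‖X k ω‖⌉₊] with n hn
    have : X k ω ∈ Metric.closedBall (0 : Plane) n := by simpa using Nat.ceil_le.1 hn
    by_cases h : X k ω ∈ B
    · rw [Set.indicator_of_mem h, Set.indicator_of_mem (show X k ω ∈ D n from ⟨h, this⟩)]
    · rw [Set.indicator_of_notMem h, Set.indicator_of_notMem (show X k ω ∉ D n from fun h' => h h'.1)]
  have hL : Tendsto (fun n => ∫⁻ ω, ∑' k, (D n).indicator (fun _ => G k ω) (X k ω) ∂P) atTop
      (𝓝 (∫⁻ ω, ∑' k, B.indicator (fun _ => G k ω) (X k ω) ∂P)) := by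
    refine tendsto_lintegral_of_tendsto_of_le (fun n => Measurable.tsum fun k => ?_)
      (fun n ω => ENNReal.tsum_le_tsum fun k => hle n k ω) (fun ω => ?_)
    · exact (hGm k).indicator (hXm k (hDm n))
    · simp_rw [← lintegral_count]
      exact tendsto_lintegral_of_tendsto_of_le (fun _ => Measurable.of_discrete)
        (fun n k => hle n k ω) (fun k => hlim k ω)
  have hvol : Tendsto (fun n => volume (D n)) atTop (𝓝 (volume B)) := by
    have hU : ⋃ n, D n = B := by
      rw [hD, ← Set.inter_iUnion, Metric.iUnion_closedBall_nat, Set.inter_univ]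
    have hmono : Monotone D := fun m n h => Set.inter_subset_inter_right _
      (Metric.closedBall_subset_closedBall (by exact_mod_cast h))
    have := tendsto_measure_iUnion_atTop (μ := (volume : Measure Plane)) hmono
    rwa [hU] at this
  refine tendsto_nhds_unique (hL.congr fun n => ?_) (ENNReal.Tendsto.mul_const
    (ENNReal.Tendsto.const_mul hvol (Or.inr ENNReal.coe_ne_top)) (Or.inr (expNeg_ne_top _)))
  exact hX.lintegral_tsum_expNeg hf hf_top (hDm n) ((measure_mono Set.inter_subset_right).trans_lt
    (measure_closedBall_lt_top (x := (0 : Plane)) (r := (n : ℝ)))).ne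

end PoissonProcess

/-! ### Integrating out independent marks -/

/-- Independent and identically distributed marks, which are independent of the points, can be
integrated out of an exponential functional. -/
theorem lintegral_mul_expNeg_tsum_mark {Ω E F : Type*} [MeasurableSpace Ω] [MeasurableSpace E]
    [MeasurableSpace F] {P : Measure Ω} [IsProbabilityMeasure P] {μ : Measure F}
    {X : ℕ → Ω → E} {M : ℕ → Ω → F} (hX : ∀ k, Measurable (X k)) (hM : ∀ k, Measurable (M k))
    (hlaw : ∀ k, HasLaw (M k) μ P) (hM_ind : iIndepFun M P)
    (hXM : IndepFun (fun ω k => X k ω) (fun ω k => M k ω) P)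
    {W : (ℕ → E) → ℝ≥0∞} (hW : Measurable W)
    {h : ℕ → E → F → ℝ≥0∞} (hh : ∀ k, Measurable (Function.uncurry (h k)))
    {f : ℕ → E → ℝ≥0∞} (hf : ∀ k x, expNeg (f k x) = ∫⁻ m, expNeg (h k x m) ∂μ) :
    ∫⁻ ω, W (fun k => X k ω) * expNeg (∑' k, h k (X k ω) (M k ω)) ∂P
      = ∫⁻ ω, W (fun k => X k ω) * expNeg (∑' k, f k (X k ω)) ∂P := by
  have hXs : Measurable fun ω k => X k ω := measurable_pi_lambda _ hX
  have hMs : Measurable fun ω k => M k ω := measurable_pi_lambda _ hM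
  -- With the points frozen at `x`, only the independence of the marks is used.
  have hinner : ∀ x : ℕ → E,
      ∫⁻ ω, expNeg (∑' k, h k (x k) (M k ω)) ∂P = expNeg (∑' k, f k (x k)) := by
    intro x
    have hm : ∀ k, Measurable fun m => expNeg (h k (x k) m) := fun k =>
      measurable_expNeg.comp ((hh k).comp measurable_prodMk_left)
    refine tendsto_nhds_unique (f := fun n : ℕ =>
      ∫⁻ ω, ∏ i ∈ Finset.range n, expNeg (h i (x i) (M i ω)) ∂P) ?_ ?_ (l := atTop)
    · refine tendsto_lintegral_of_dominated_convergence (fun _ => 1) (fun n => ?_) (fun n => ?_)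
        (by simp) (Eventually.of_forall fun ω => tendsto_prod_expNeg _)
      · exact Finset.measurable_prod _ fun i _ => (hm i).comp (hM i)
      · exact Eventually.of_forall fun ω => Finset.prod_le_one' fun i _ => expNeg_le_one _
    · refine (tendsto_prod_expNeg fun k => f k (x k)).congr fun n => ?_
      rw [lintegral_prod_eq_prod_lintegral_of_indepFun _
        (fun i ω => expNeg (h i (x i) (M i ω))) (hM_ind.comp _ hm) (fun i => (hm i).comp (hM i))]
      refine Finset.prod_congr rfl fun i _ => ?_
      rw [hf, ← (hlaw i).lintegral_comp (hm i).aemeasurable]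
  have hjoint : Measurable fun z : (ℕ → E) × (ℕ → F) =>
      W z.1 * expNeg (∑' k, h k (z.1 k) (z.2 k)) := by
    refine (hW.comp measurable_fst).mul (measurable_expNeg.comp (Measurable.tsum fun k => ?_))
    have hk : Measurable fun z : (ℕ → E) × (ℕ → F) => (z.1 k, z.2 k) := by fun_prop
    exact (hh k).comp hk
  have hG : ∀ x : ℕ → E, Measurable fun m : ℕ → F => expNeg (∑' k, h k (x k) (m k)) := fun x =>
    measurable_expNeg.comp (Measurable.tsum fun k =>
      (hh k).comp (measurable_const.prodMk (measurable_pi_apply k)))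
  -- The functions `f k` are not assumed measurable; `expNeg ∘ f k` is, being a parameter integral,
  -- and this suffices by passing to the limit of finite products.
  have hf' : Measurable fun x : ℕ → E => expNeg (∑' k, f k (x k)) := by
    have h1 : ∀ k, Measurable fun x => expNeg (f k x) := fun k => by
      have : SFinite μ := by
        have := (hlaw k).isProbabilityMeasure_iff.1 inferInstance
        infer_instance
      simp_rw [hf]
      exact (measurable_expNeg.comp (hh k)).lintegral_prod_right'
    exact measurable_of_tendsto_metrizable (f := fun n (x : ℕ → E) =>
      ∏ i ∈ Finset.range n, expNeg (f i (x i)))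
      (fun n => Finset.measurable_prod _ fun i _ => (h1 i).comp (measurable_pi_apply i))
      (tendsto_pi_nhds.2 fun x => tendsto_prod_expNeg _)
  calc ∫⁻ ω, W (fun k => X k ω) * expNeg (∑' k, h k (X k ω) (M k ω)) ∂P
      = ∫⁻ z, W z.1 * expNeg (∑' k, h k (z.1 k) (z.2 k))
          ∂(P.map fun ω => ((fun k => X k ω), fun k => M k ω)) := by
        rw [lintegral_map hjoint (hXs.prodMk hMs)]
    _ = ∫⁻ x, W x * expNeg (∑' k, f k (x k)) ∂(P.map fun ω k => X k ω) := by
        rw [(indepFun_iff_map_prod_eq_prod_map_map hXs.aemeasurable hMs.aemeasurable).1 hXM,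
          lintegral_prod _ hjoint.aemeasurable]
        refine lintegral_congr fun x => ?_
        simp only
        rw [lintegral_const_mul _ (hG x), lintegral_map (hG x) hMs, hinner]
    _ = _ := lintegral_map (hW.mul hf') hXs

/-! ### Laplace transform of the received power, given the location of the transmitter -/

lemma integral_exp_neg_mul_sq_gaussianReal (v : ℝ≥0) {t : ℝ} (ht : 0 ≤ t) :
    ∫ x, Real.exp (-(t * x ^ 2)) ∂(gaussianReal 0 v) = Real.sqrt (1 / (1 + 2 * t * v)) := by
  rcases eq_or_ne v 0 with rfl | hv
  · simp
  have hv' : (0 : ℝ) < v := by positivity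
  rw [integral_gaussianReal_eq_integral_smul hv]
  have h : ∀ x : ℝ, gaussianPDFReal 0 v x • Real.exp (-(t * x ^ 2))
      = (Real.sqrt (2 * Real.pi * v))⁻¹ * Real.exp (-(1 / (2 * v) + t) * x ^ 2) := by
    intro x
    rw [gaussianPDFReal, smul_eq_mul, mul_assoc, ← Real.exp_add]
    congr 2
    ring
  simp_rw [h]
  rw [integral_const_mul, integral_gaussian, ← Real.sqrt_inv, ← Real.sqrt_mul (by positivity)]
  congr 1
  field_simp

lemma lintegral_exp_neg_mul_sq_gaussianReal (v : ℝ≥0) {t : ℝ} (ht : 0 ≤ t) :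
    ∫⁻ x, ENNReal.ofReal (Real.exp (-(t * x ^ 2))) ∂(gaussianReal 0 v)
      = ENNReal.ofReal (Real.sqrt (1 / (1 + 2 * t * v))) := by
  rw [← integral_exp_neg_mul_sq_gaussianReal v ht, ofReal_integral_eq_lintegral_ofReal]
  · refine Integrable.of_bound (by fun_prop) 1 (Eventually.of_forall fun x => ?_)
    rw [Real.norm_of_nonneg (Real.exp_nonneg _), Real.exp_le_one_iff]
    have := mul_nonneg ht (sq_nonneg x)
    linarith
  · exact Eventually.of_forall fun x => Real.exp_nonneg _

lemma lintegral_complexGaussian {v : ℝ≥0} {f : ℂ → ℝ≥0∞} (hf : Measurable f) :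
    ∫⁻ z, f z ∂(complexGaussian v)
      = ∫⁻ x, ∫⁻ y, f ⟨x, y⟩ ∂(gaussianReal 0 (v / 2)) ∂(gaussianReal 0 (v / 2)) := by
  have hm : Measurable fun z : ℝ × ℝ => (⟨z.1, z.2⟩ : ℂ) :=
    Complex.measurableEquivRealProd.symm.measurable
  rw [complexGaussian, lintegral_map hf hm]
  exact lintegral_prod _ (hf.comp hm).aemeasurable

instance (v : ℝ≥0) : IsProbabilityMeasure (complexGaussian v) :=
  Measure.isProbabilityMeasure_map
    (Complex.measurableEquivRealProd.symm.measurable.aemeasurable :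
      AEMeasurable (fun z : ℝ × ℝ => (⟨z.1, z.2⟩ : ℂ)) _)

/-- Under the product law, `a x + b y` is a centred Gaussian of variance `a² v + b² w`, by the
convolution of Gaussian laws. -/
lemma lintegral_exp_neg_mul_sq_linear_combination (a b : ℝ) (v w : ℝ≥0) {t : ℝ} (ht : 0 ≤ t) :
    ∫⁻ x, ∫⁻ y, ENNReal.ofReal (Real.exp (-(t * (a * x + b * y) ^ 2)))
        ∂(gaussianReal 0 w) ∂(gaussianReal 0 v)
      = ENNReal.ofReal (Real.sqrt (1 / (1 + 2 * t * (a ^ 2 * v + b ^ 2 * w)))) := by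
  have h := gaussianReal_conv_gaussianReal (m₁ := 0) (m₂ := 0) (v₁ := .mk (a ^ 2) (sq_nonneg _) * v)
    (v₂ := .mk (b ^ 2) (sq_nonneg _) * w)
  have ha := gaussianReal_map_const_mul (μ := 0) (v := v) a
  have hb := gaussianReal_map_const_mul (μ := 0) (v := w) b
  rw [mul_zero] at ha hb
  have h3 := lintegral_exp_neg_mul_sq_gaussianReal
    (.mk (a ^ 2) (sq_nonneg _) * v + .mk (b ^ 2) (sq_nonneg _) * w) ht
  rw [add_zero] at h
  rw [← h, ← ha, ← hb, Measure.lintegral_conv (by fun_prop),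
    lintegral_map (by fun_prop) (by fun_prop)] at h3
  have h4 : ∀ x, ∫⁻ y, ENNReal.ofReal (Real.exp (-(t * (a * x + y) ^ 2)))
      ∂((gaussianReal 0 w).map (b * ·))
      = ∫⁻ y, ENNReal.ofReal (Real.exp (-(t * (a * x + b * y) ^ 2))) ∂(gaussianReal 0 w) :=
    fun x => lintegral_map (by fun_prop) (by fun_prop)
  simp_rw [h4] at h3
  rw [h3]
  simp

/-- A linear combination of independent complex Gaussian coefficients has an exponentially
distributed square modulus. -/
lemma lintegral_exp_neg_mul_norm_sq_complexGaussian (a b : ℝ) (v w : ℝ≥0) {t : ℝ} (ht : 0 ≤ t) :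
    ∫⁻ z, ∫⁻ z', ENNReal.ofReal (Real.exp (-(t * ‖(a : ℂ) * z + (b : ℂ) * z'‖ ^ 2)))
        ∂(complexGaussian w) ∂(complexGaussian v)
      = ENNReal.ofReal (1 / (1 + t * (a ^ 2 * v + b ^ 2 * w))) := by
  -- The squared modulus splits into real and imaginary parts, so the integral is the square of a
  -- real one. Squaring removes the root, and the variances `v / 2`, `w / 2` absorb the factor `2`.
  set K : ℝ → ℝ≥0∞ := fun x =>
    ∫⁻ y, ENNReal.ofReal (Real.exp (-(t * (a * x + b * y) ^ 2))) ∂(gaussianReal 0 (w / 2)) with hK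
  have hKm : Measurable K := by
    refine Measurable.lintegral_prod_right' (f := fun z : ℝ × ℝ =>
      ENNReal.ofReal (Real.exp (-(t * (a * z.1 + b * z.2) ^ 2)))) (by fun_prop)
  have h1 : ∀ z : ℂ, ∫⁻ z', ENNReal.ofReal (Real.exp (-(t * ‖(a : ℂ) * z + (b : ℂ) * z'‖ ^ 2)))
      ∂(complexGaussian w) = K z.re * K z.im := by
    intro z
    rw [lintegral_complexGaussian (by fun_prop), hK]
    simp only
    rw [← lintegral_mul_const _ (by fun_prop)]
    refine lintegral_congr fun x => ?_
    rw [← lintegral_const_mul _ (by fun_prop)]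
    refine lintegral_congr fun y => ?_
    rw [← ENNReal.ofReal_mul (Real.exp_nonneg _), ← Real.exp_add, ← Complex.normSq_eq_norm_sq,
      Complex.normSq_apply]
    simp only [Complex.add_re, Complex.mul_re, Complex.ofReal_re, Complex.ofReal_im, zero_mul,
      sub_zero, Complex.add_im, Complex.mul_im, add_zero]
    ring_nf
  simp_rw [h1]
  rw [lintegral_complexGaussian (by fun_prop)]
  simp only
  simp_rw [lintegral_const_mul _ hKm]
  rw [lintegral_mul_const _ hKm, hK]
  simp only
  rw [lintegral_exp_neg_mul_sq_linear_combination _ _ _ _ ht,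
    ← ENNReal.ofReal_mul (Real.sqrt_nonneg _), Real.mul_self_sqrt (by positivity)]
  congr 2
  push_cast
  ring

/-- The power received by the user from a transmitter at `x` with the mark `m`, under the distance
approximation. -/
def receivedPower (Cd Cr d0 α : ℝ) (x : Plane) (m : Mark) : ℝ :=
  if m.1 = true then
    ‖((Real.sqrt (directPathLoss Cd α ‖x‖) : ℝ) : ℂ) * m.2.2.1
      + ((Real.sqrt (reflectedPathLoss Cr α d0 ‖x‖) : ℝ) : ℂ) * m.2.2.2‖ ^ 2
  else
    ‖((Real.sqrt (directPathLoss Cd α ‖x‖) : ℝ) : ℂ) * m.2.2.1‖ ^ 2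

lemma receivedPower_nonneg (Cd Cr d0 α : ℝ) (x : Plane) (m : Mark) :
    0 ≤ receivedPower Cd Cr d0 α x m := by
  unfold receivedPower
  split_ifs <;> positivity

lemma measurable_receivedPower (Cd Cr d0 α : ℝ) :
    Measurable (Function.uncurry (receivedPower Cd Cr d0 α)) := by
  unfold Function.uncurry receivedPower directPathLoss reflectedPathLoss
  refine Measurable.ite ?_ (by fun_prop) (by fun_prop)
  exact (measurable_fst.comp measurable_snd) (measurableSet_singleton true)

instance : IsProbabilityMeasure (cond (volume : Measure ℝ) (Ico (-Real.pi) Real.pi)) := by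
  refine cond_isProbabilityMeasure_of_finite ?_ ?_
  · simp [Real.pi_pos]
  · simp

instance (p : unitInterval) (N : ℕ) : IsProbabilityMeasure (markLaw p N) := by
  unfold markLaw
  infer_instance

lemma lintegral_markLaw (p : unitInterval) (N : ℕ) {f : Mark → ℝ≥0∞} (hf : Measurable f)
    {g : Bool → ℂ → ℂ → ℝ≥0∞} (hfg : ∀ m, f m = g m.1 m.2.2.1 m.2.2.2) :
    ∫⁻ m, f m ∂(markLaw p N)
      = ENNReal.ofReal p * (∫⁻ z, ∫⁻ z', g true z z' ∂(complexGaussian N) ∂(complexGaussian 1))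
        + ENNReal.ofReal (1 - p)
          * (∫⁻ z, ∫⁻ z', g false z z' ∂(complexGaussian N) ∂(complexGaussian 1)) := by
  have h : ∀ b : Bool, ∫⁻ r, f (b, r) ∂((cond volume (Ico (-Real.pi) Real.pi)).prod
      ((complexGaussian 1).prod (complexGaussian (N : ℝ≥0))))
      = ∫⁻ z, ∫⁻ z', g b z z' ∂(complexGaussian N) ∂(complexGaussian 1) := by
    intro b
    rw [lintegral_prod _ (by fun_prop)]
    have h2 : ∀ θ : ℝ, ∫⁻ w, f (b, θ, w) ∂((complexGaussian 1).prod (complexGaussian (N : ℝ≥0)))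
        = ∫⁻ z, ∫⁻ z', g b z z' ∂(complexGaussian N) ∂(complexGaussian 1) := by
      intro θ
      rw [lintegral_prod _ (by fun_prop)]
      simp_rw [hfg]
    simp_rw [h2]
    simp
  rw [markLaw, lintegral_prod _ hf.aemeasurable, bernoulliMeasure_def, lintegral_add_measure,
    lintegral_smul_measure, lintegral_smul_measure, lintegral_dirac, lintegral_dirac, h, h,
    ENNReal.smul_def, ENNReal.smul_def, smul_eq_mul, smul_eq_mul]
  congr 2
  · rw [← ENNReal.ofReal_coe_nnreal]; rfl
  · rw [← ENNReal.ofReal_coe_nnreal]; rfl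

lemma lintegral_expNeg_receivedPower (p : unitInterval) (N : ℕ) {Cd Cr d0 α s : ℝ} (hCd : 0 < Cd)
    (hCr : 0 < Cr) (hd0 : 0 < d0) (hs : 0 ≤ s) {x : Plane} (hx : x ≠ 0) :
    ∫⁻ m, expNeg (ENNReal.ofReal (s * receivedPower Cd Cr d0 α x m)) ∂(markLaw p N)
      = ENNReal.ofReal (p * (1 / (1 + s * (e1 N Cd Cr d0 α * ‖x‖ ^ (-α))))
        + (1 - p) * (1 / (1 + s * (Cd * ‖x‖ ^ (-α))))) := by
  have hx' : 0 < ‖x‖ := norm_pos_iff.2 hx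
  have hp0 : (0 : ℝ) ≤ p := p.2.1
  have hp1 : (0 : ℝ) ≤ 1 - p := sub_nonneg.2 p.2.2
  have he1 : 0 < e1 N Cd Cr d0 α := by unfold e1; positivity
  have hm : Measurable fun m => receivedPower Cd Cr d0 α x m :=
    (measurable_receivedPower Cd Cr d0 α).comp measurable_prodMk_left
  set a := Real.sqrt (directPathLoss Cd α ‖x‖) with ha
  set b := Real.sqrt (reflectedPathLoss Cr α d0 ‖x‖) with hb
  have ha2 : a ^ 2 = Cd * ‖x‖ ^ (-α) :=
    Real.sq_sqrt (by unfold directPathLoss; positivity)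
  have hb2 : b ^ 2 = Cr * d0 ^ (-α) * ‖x‖ ^ (-α) := by
    rw [hb, Real.sq_sqrt (by unfold reflectedPathLoss; positivity), reflectedPathLoss,
      Real.mul_rpow hd0.le hx'.le]
    ring
  -- A transmitter without RIS is treated as one whose reflected amplitude is `0`, so one Gaussian
  -- formula covers both cases.
  rw [lintegral_markLaw p N (by fun_prop) (g := fun c z z' =>
    ENNReal.ofReal (Real.exp (-(s * ‖(a : ℂ) * z + ((if c = true then b else 0 : ℝ) : ℂ) * z'‖ ^ 2))))]
  · simp only [if_true, Bool.false_eq_true, if_false]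
    rw [lintegral_exp_neg_mul_norm_sq_complexGaussian _ _ _ _ hs,
      lintegral_exp_neg_mul_norm_sq_complexGaussian _ _ _ _ hs, ha2, hb2,
      ← ENNReal.ofReal_mul hp0, ← ENNReal.ofReal_mul hp1, ← ENNReal.ofReal_add]
    · congr 1
      simp only [NNReal.coe_one, NNReal.coe_natCast, e1]
      ring_nf
    · positivity
    · positivity
  · intro m
    rw [expNeg_ofReal (mul_nonneg hs (receivedPower_nonneg _ _ _ _ _ _)), receivedPower]
    split_ifs <;> simp [ha, hb]

/-! ### A radial integral in the plane -/

/-- Polar coordinates reduce this to a one-dimensional Gamma integral. -/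
lemma integral_exp_neg_mul_norm_rpow {α b : ℝ} (hα : 0 < α) (hb : 0 < b) :
    ∫ x : Plane, Real.exp (-b * ‖x‖ ^ α)
      = 2 * Real.pi * (b ^ (-(2 / α)) * (1 / α) * Real.Gamma (2 / α)) := by
  have h := integral_fun_norm_addHaar (volume : Measure Plane) (fun r => Real.exp (-b * r ^ α))
  rw [h]
  have h2 : (volume : Measure Plane).real (Metric.ball 0 1) = Real.pi := by
    rw [Measure.real, EuclideanSpace.volume_ball_fin_two]
    simp [Real.pi_nonneg]
  have h1 := integral_rpow_mul_exp_neg_mul_rpow hα (q := 1) (by norm_num) hb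
  have h3 : ∀ y : ℝ, y ^ (Module.finrank ℝ Plane - 1) • Real.exp (-b * y ^ α)
      = y ^ (1 : ℝ) * Real.exp (-b * y ^ α) := fun y => by simp
  simp_rw [h3, h1, h2]
  norm_num
  rw [neg_div]
  ring

/-- The Bochner integral of a non-integrable function is `0` by convention, so a nonzero value
already certifies integrability. -/
lemma lintegral_ofReal_of_integral_ne_zero {β : Type*} [MeasurableSpace β] {μ : Measure β}
    {f : β → ℝ} (h0 : 0 ≤ᵐ[μ] f) (h : ∫ x, f x ∂μ ≠ 0) :
    ∫⁻ x, ENNReal.ofReal (f x) ∂μ = ENNReal.ofReal (∫ x, f x ∂μ) :=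
  (ofReal_integral_eq_lintegral_ofReal (not_imp_comm.1 integral_undef h) h0).symm

/-- Write `c / (r ^ α + c)` as the integral of `c e^(-c y) e^(-y r ^ α)` over `y > 0` and swap the
integrals. The plane integral yields `Γ(2/α) y ^ (-2/α)` up to constants, the remaining one `Γ(1 -
2/α)`, which needs `α > 2`; reflection turns the product into the cosecant. -/
theorem lintegral_div_norm_rpow_add {α c : ℝ} (hα : 2 < α) (hc : 0 ≤ c) :
    ∫⁻ x : Plane, ENNReal.ofReal (c / (‖x‖ ^ α + c))
      = ENNReal.ofReal (2 * Real.pi ^ 2 * (Real.sin (2 * Real.pi / α))⁻¹ * c ^ (2 / α) / α) := by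
  have hα0 : 0 < α := by linarith
  have h2α : 0 < 2 / α := by positivity
  have h2α1 : 2 / α < 1 := by rw [div_lt_one hα0]; exact hα
  rcases hc.eq_or_lt with rfl | hc
  · simp [Real.zero_rpow h2α.ne']
  have hstep : ∀ x : Plane, ENNReal.ofReal (c / (‖x‖ ^ α + c))
      = ∫⁻ y in Ioi (0 : ℝ), ENNReal.ofReal (c * Real.exp (-c * y))
        * ENNReal.ofReal (Real.exp (-y * ‖x‖ ^ α)) := by
    intro x
    have hx : 0 < ‖x‖ ^ α + c := by positivity
    have h1 : ∫ y in Ioi (0 : ℝ), Real.exp (-(‖x‖ ^ α + c) * y) = 1 / (‖x‖ ^ α + c) := by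
      rw [integral_exp_mul_Ioi (neg_lt_zero.2 hx), mul_zero, Real.exp_zero, neg_div_neg_eq]
    have h2 : ∫ y in Ioi (0 : ℝ), c * Real.exp (-(‖x‖ ^ α + c) * y) = c / (‖x‖ ^ α + c) := by
      rw [integral_const_mul, h1]
      ring
    rw [← h2, ← lintegral_ofReal_of_integral_ne_zero
      (Eventually.of_forall fun y => by positivity) (by rw [h2]; positivity)]
    refine lintegral_congr fun y => ?_
    rw [← ENNReal.ofReal_mul (by positivity), mul_assoc, ← Real.exp_add]
    ring_nf
  simp_rw [hstep]
  rw [lintegral_lintegral_swap (by fun_prop)]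
  have hin : ∀ y ∈ Ioi (0 : ℝ), ∫⁻ x : Plane, ENNReal.ofReal (c * Real.exp (-c * y))
        * ENNReal.ofReal (Real.exp (-y * ‖x‖ ^ α))
      = ENNReal.ofReal (2 * Real.pi * (1 / α) * Real.Gamma (2 / α) * c)
        * ENNReal.ofReal (y ^ ((1 - 2 / α) - 1) * Real.exp (-(c * y))) := by
    intro y hy
    have hy : 0 < y := hy
    have hG := Real.Gamma_pos_of_pos h2α
    have hI := integral_exp_neg_mul_norm_rpow hα0 hy
    have hne : ∫ x : Plane, Real.exp (-y * ‖x‖ ^ α) ≠ 0 := by rw [hI]; positivity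
    rw [lintegral_const_mul _ (by fun_prop), lintegral_ofReal_of_integral_ne_zero
      (Eventually.of_forall fun x => by positivity) hne, hI, ← ENNReal.ofReal_mul (by positivity),
      ← ENNReal.ofReal_mul (by positivity)]
    congr 1
    rw [show (1 - 2 / α) - 1 = -(2 / α) by ring, neg_mul]
    ring
  rw [setLIntegral_congr_fun measurableSet_Ioi hin, lintegral_const_mul _ (by fun_prop)]
  have hJ := Real.integral_rpow_mul_exp_neg_mul_Ioi (a := 1 - 2 / α) (by linarith) hc
  have hG1 := Real.Gamma_pos_of_pos (show 0 < 1 - 2 / α by linarith)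
  rw [lintegral_ofReal_of_integral_ne_zero _ (by rw [hJ]; positivity), hJ,
    ← ENNReal.ofReal_mul (by have := Real.Gamma_pos_of_pos h2α; positivity)]
  · congr 1
    have hrefl := Real.Gamma_mul_Gamma_one_sub (2 / α)
    have hpow : c * (1 / c) ^ (1 - 2 / α) = c ^ (2 / α) := by
      rw [one_div, Real.inv_rpow hc.le, ← Real.rpow_neg hc.le, ← Real.rpow_one_add' hc.le]
      · ring_nf
      · rw [show 1 + -(1 - 2 / α) = 2 / α by ring]; exact h2α.ne'
    calc 2 * Real.pi * (1 / α) * Real.Gamma (2 / α) * c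
          * ((1 / c) ^ (1 - 2 / α) * Real.Gamma (1 - 2 / α))
        = 2 * Real.pi * (1 / α) * (Real.Gamma (2 / α) * Real.Gamma (1 - 2 / α))
          * (c * (1 / c) ^ (1 - 2 / α)) := by ring
      _ = _ := by
        rw [hrefl, hpow, show Real.pi * (2 / α) = 2 * Real.pi / α by ring]
        ring
  · filter_upwards [ae_restrict_mem measurableSet_Ioi] with y hy
    have hy : 0 < y := hy
    positivity

/-! ### The interference of the network -/

/-- The Laplace transform of the power received from a transmitter at `x`, with respect to the law
of the mark. -/
def markLaplace (p : unitInterval) (N : ℕ) (Cd Cr d0 α s : ℝ) (x : Plane) : ℝ≥0∞ :=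
  ∫⁻ m, expNeg (ENNReal.ofReal (s * receivedPower Cd Cr d0 α x m)) ∂(markLaw p N)

section markLaplace

variable (p : unitInterval) (N : ℕ) (Cd Cr d0 α s : ℝ)

lemma measurable_uncurry_ofReal_receivedPower :
    Measurable (Function.uncurry fun (x : Plane) (m : Mark) =>
      ENNReal.ofReal (s * receivedPower Cd Cr d0 α x m)) :=
  ((measurable_receivedPower Cd Cr d0 α).const_mul s).ennreal_ofReal

lemma measurable_markLaplace : Measurable (markLaplace p N Cd Cr d0 α s) :=
  (measurable_expNeg.comp
    (measurable_uncurry_ofReal_receivedPower Cd Cr d0 α s)).lintegral_prod_right'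

lemma markLaplace_le_one (x : Plane) : markLaplace p N Cd Cr d0 α s x ≤ 1 := by
  calc markLaplace p N Cd Cr d0 α s x ≤ ∫⁻ _, 1 ∂(markLaw p N) :=
        lintegral_mono fun _ => expNeg_le_one _
    _ = 1 := by simp

/-- Makes `negLog` of it finite, so that the factor of the serving point can be cancelled in the
reduced Campbell formula. -/
lemma markLaplace_ne_zero (x : Plane) : markLaplace p N Cd Cr d0 α s x ≠ 0 := by
  have hm : Measurable fun m => expNeg (ENNReal.ofReal (s * receivedPower Cd Cr d0 α x m)) :=
    measurable_expNeg.comp ((measurable_uncurry_ofReal_receivedPower Cd Cr d0 α s).comp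
      measurable_prodMk_left)
  intro h
  obtain ⟨m, hm⟩ := ((lintegral_eq_zero_iff hm).1 h).exists
  exact expNeg_ne_zero ENNReal.ofReal_ne_top hm

variable {Cd Cr d0 α s}

lemma lintegral_one_sub_markLaplace (hCd : 0 < Cd) (hCr : 0 < Cr) (hd0 : 0 < d0) (hα : 2 < α)
    (hs : 0 ≤ s) :
    ∫⁻ x, (1 - markLaplace p N Cd Cr d0 α s x)
      = ENNReal.ofReal (p * (2 * Real.pi ^ 2 * (Real.sin (2 * Real.pi / α))⁻¹
            * (e1 N Cd Cr d0 α * s) ^ (2 / α) / α)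
          + (1 - p) * (2 * Real.pi ^ 2 * (Real.sin (2 * Real.pi / α))⁻¹
            * (Cd * s) ^ (2 / α) / α)) := by
  have hp0 : (0 : ℝ) ≤ p := p.2.1
  have hp1 : (0 : ℝ) ≤ 1 - p := sub_nonneg.2 p.2.2
  have he1 : 0 < e1 N Cd Cr d0 α := by unfold e1; positivity
  have hsin : 0 < Real.sin (2 * Real.pi / α) := by
    apply Real.sin_pos_of_pos_of_lt_pi
    · have := Real.pi_pos
      positivity
    · rw [div_lt_iff₀ (by linarith)]
      nlinarith [Real.pi_pos]
  have hae : ∀ᵐ x : Plane, 1 - markLaplace p N Cd Cr d0 α s x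
      = ENNReal.ofReal p
          * ENNReal.ofReal (e1 N Cd Cr d0 α * s / (‖x‖ ^ α + e1 N Cd Cr d0 α * s))
        + ENNReal.ofReal (1 - p) * ENNReal.ofReal (Cd * s / (‖x‖ ^ α + Cd * s)) := by
    -- The origin, where the path loss is singular, is a null set.
    filter_upwards [Measure.ae_ne volume (0 : Plane)] with x hx
    have hx' : 0 < ‖x‖ := norm_pos_iff.2 hx
    have hr : 0 < ‖x‖ ^ α := by positivity
    rw [markLaplace, lintegral_expNeg_receivedPower p N hCd hCr hd0 hs hx, ← ENNReal.ofReal_one,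
      ← ENNReal.ofReal_sub _ (by positivity), ← ENNReal.ofReal_mul hp0, ← ENNReal.ofReal_mul hp1,
      ← ENNReal.ofReal_add (by positivity) (by positivity), Real.rpow_neg hx'.le]
    congr 1
    have key : ∀ c : ℝ, 0 < c → c * s / (‖x‖ ^ α + c * s)
        = 1 - 1 / (1 + s * (c * (‖x‖ ^ α)⁻¹)) := by
      intro c hc
      have h1 : 0 < ‖x‖ ^ α + c * s := by positivity
      have h2 : 1 + s * (c * (‖x‖ ^ α)⁻¹) = (‖x‖ ^ α + c * s) / ‖x‖ ^ α := by
        field_simp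
      rw [h2, one_div_div, eq_sub_iff_add_eq, ← add_div, add_comm, div_self h1.ne']
    rw [key _ he1, key _ hCd]
    ring
  rw [lintegral_congr_ae hae, lintegral_add_left (by fun_prop), lintegral_const_mul _ (by fun_prop),
    lintegral_const_mul _ (by fun_prop), lintegral_div_norm_rpow_add hα (by positivity),
    lintegral_div_norm_rpow_add hα (by positivity), ← ENNReal.ofReal_mul hp0,
    ← ENNReal.ofReal_mul hp1, ← ENNReal.ofReal_add (by positivity) (by positivity)]

lemma expNeg_mul_lintegral_one_sub_markLaplace (lam : ℝ≥0) (hCd : 0 < Cd) (hCr : 0 < Cr)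
    (hd0 : 0 < d0) (hα : 2 < α) (hs : 0 ≤ s) :
    expNeg (lam * ∫⁻ x, (1 - markLaplace p N Cd Cr d0 α s x))
      = ENNReal.ofReal
          (laplaceFactor lam p (e1 N Cd Cr d0 α) α s * laplaceFactor lam (1 - p) Cd α s) := by
  have hp0 : (0 : ℝ) ≤ p := p.2.1
  have hp1 : (0 : ℝ) ≤ 1 - p := sub_nonneg.2 p.2.2
  have he1 : 0 < e1 N Cd Cr d0 α := by unfold e1; positivity
  have hsin : 0 < Real.sin (2 * Real.pi / α) := by
    apply Real.sin_pos_of_pos_of_lt_pi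
    · have := Real.pi_pos
      positivity
    · rw [div_lt_iff₀ (by linarith)]
      nlinarith [Real.pi_pos]
  rw [lintegral_one_sub_markLaplace p N hCd hCr hd0 hα hs, ← ENNReal.ofReal_coe_nnreal,
    ← ENNReal.ofReal_mul (by positivity), expNeg_ofReal (by positivity), laplaceFactor,
    laplaceFactor, ← Real.exp_add]
  congr 2
  ring

end markLaplace

lemma tendsto_laplaceFactor_zero (lam q c : ℝ) {α : ℝ} (hα : 0 < α) :
    Tendsto (laplaceFactor lam q c α) (𝓝 0) (𝓝 1) := by
  have h2α : 0 < 2 / α := by positivity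
  have hc : Continuous (laplaceFactor lam q c α) := by
    unfold laplaceFactor
    have : Continuous fun s : ℝ => (c * s) ^ (2 / α) :=
      (continuous_const.mul continuous_id).rpow_const fun _ => Or.inr h2α.le
    fun_prop
  have h0 : laplaceFactor lam q c α 0 = 1 := by
    simp [laplaceFactor, Real.zero_rpow h2α.ne']
  simpa [h0] using hc.tendsto 0

namespace RISNetwork

variable {Ω : Type*} [MeasurableSpace Ω] {P : Measure Ω} {lam : ℝ≥0} {p : unitInterval} {N : ℕ}

lemma power_nonneg (net : RISNetwork P lam p N) (Cd Cr d0 α : ℝ) (k : ℕ) (ω : Ω) :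
    0 ≤ net.power Cd Cr d0 α k ω := receivedPower_nonneg _ _ _ _ _ _

lemma measurable_power (net : RISNetwork P lam p N) (Cd Cr d0 α : ℝ) (k : ℕ) :
    Measurable (net.power Cd Cr d0 α k) :=
  (measurable_receivedPower Cd Cr d0 α).comp
    ((net.isHPPP_tx.measurable k).prodMk (net.measurable_mark k))

/-- Summability is essential: a divergent real `tsum` is `0` by convention, while the sum in `[0,
∞]` is `∞`. -/
lemma ofReal_exp_neg_mul_interference (net : RISNetwork P lam p N) {Cd Cr d0 α s : ℝ} (hs : 0 ≤ s)
    (serving : Option ℕ) {ω : Ω} (hω : Summable fun k => net.power Cd Cr d0 α k ω) :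
    ENNReal.ofReal (Real.exp (-s * net.interference Cd Cr d0 α serving ω))
      = expNeg (∑' k, if serving = some k then 0
          else ENNReal.ofReal (s * net.power Cd Cr d0 α k ω)) := by
  have hnn : ∀ k, 0 ≤ if serving = some k then 0 else net.power Cd Cr d0 α k ω := fun k => by
    split_ifs
    exacts [le_rfl, net.power_nonneg _ _ _ _ _ _]
  have hsum : Summable fun k => if serving = some k then 0 else net.power Cd Cr d0 α k ω :=
    Summable.of_nonneg_of_le hnn (fun k => by
      split_ifs
      exacts [net.power_nonneg _ _ _ _ _ _, le_rfl]) hω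
  rw [neg_mul, interference, ← expNeg_ofReal (mul_nonneg hs (tsum_nonneg hnn)), ← tsum_mul_left,
    ENNReal.ofReal_tsum_of_nonneg (fun k => mul_nonneg hs (hnn k)) (hsum.mul_left s)]
  congr 2 with k
  split_ifs <;> simp

/-- Integrating out the marks of all the transmitters which do not serve the user. -/
lemma lintegral_mul_expNeg_tsum_power [IsProbabilityMeasure P] (net : RISNetwork P lam p N)
    (Cd Cr d0 α s : ℝ) (serving : Option ℕ) {W : (ℕ → Plane) → ℝ≥0∞} (hW : Measurable W) :
    ∫⁻ ω, W (fun k => net.tx k ω) * expNeg (∑' k, if serving = some k then 0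
        else ENNReal.ofReal (s * net.power Cd Cr d0 α k ω)) ∂P
      = ∫⁻ ω, W (fun k => net.tx k ω) * expNeg (∑' k, if serving = some k then 0
        else negLog (markLaplace p N Cd Cr d0 α s (net.tx k ω))) ∂P := by
  refine lintegral_mul_expNeg_tsum_mark (μ := markLaw p N)
    (h := fun k x m => if serving = some k then 0
      else ENNReal.ofReal (s * receivedPower Cd Cr d0 α x m))
    (f := fun k x => if serving = some k then 0 else negLog (markLaplace p N Cd Cr d0 α s x))
    net.isHPPP_tx.measurable net.measurable_mark net.law_mark net.iIndepFun_mark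
    net.indepFun_tx_mark hW (fun k => ?_) (fun k x => ?_)
  · by_cases hk : serving = some k
    · simp only [hk, if_true]
      exact measurable_const
    · simp only [hk, if_false]
      exact measurable_uncurry_ofReal_receivedPower Cd Cr d0 α s
  · by_cases hk : serving = some k
    · simp [hk]
    · simp only [hk, if_false]
      exact expNeg_negLog (markLaplace_le_one p N Cd Cr d0 α s x)

theorem lintegral_expNeg_tsum_power [IsProbabilityMeasure P] (net : RISNetwork P lam p N)
    {Cd Cr d0 α s : ℝ} (hCd : 0 < Cd) (hCr : 0 < Cr) (hd0 : 0 < d0) (hα : 2 < α) (hs : 0 ≤ s) :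
    ∫⁻ ω, expNeg (∑' k, ENNReal.ofReal (s * net.power Cd Cr d0 α k ω)) ∂P
      = ENNReal.ofReal
          (laplaceFactor lam p (e1 N Cd Cr d0 α) α s * laplaceFactor lam (1 - p) Cd α s) := by
  have h := net.lintegral_mul_expNeg_tsum_power Cd Cr d0 α s none (W := fun _ => 1) measurable_const
  simp only [reduceCtorEq, if_false, one_mul] at h
  rw [h, net.isHPPP_tx.lintegral_expNeg_tsum (f := fun x => negLog (markLaplace p N Cd Cr d0 α s x))
    (measurable_negLog.comp (measurable_markLaplace p N Cd Cr d0 α s)),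
    ← expNeg_mul_lintegral_one_sub_markLaplace p N lam hCd hCr hd0 hα hs]
  simp_rw [expNeg_negLog (markLaplace_le_one p N Cd Cr d0 α s _)]

/-- For `s > 0` the variable `e^(-s S)` vanishes where `S = ∞`, so its expectation is at most the
probability that `S` is finite. Along `s = 1 / (n + 1)` this expectation, known explicitly, tends to
`1`. -/
theorem ae_summable_power [IsProbabilityMeasure P] (net : RISNetwork P lam p N)
    {Cd Cr d0 α : ℝ} (hCd : 0 < Cd) (hCr : 0 < Cr) (hd0 : 0 < d0) (hα : 2 < α) :
    ∀ᵐ ω ∂P, Summable fun k => net.power Cd Cr d0 α k ω := by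
  set S : Ω → ℝ≥0∞ := fun ω => ∑' k, ENNReal.ofReal (net.power Cd Cr d0 α k ω) with hS
  have hSm : Measurable S := Measurable.tsum fun k => (net.measurable_power _ _ _ _ k).ennreal_ofReal
  have hset : MeasurableSet {ω | S ω ≠ ∞} := (hSm (measurableSet_singleton ∞)).compl
  have hbound : ∀ n : ℕ, ENNReal.ofReal
      (laplaceFactor lam p (e1 N Cd Cr d0 α) α (1 / (n + 1)) *
        laplaceFactor lam (1 - p) Cd α (1 / (n + 1))) ≤ P {ω | S ω ≠ ∞} := by
    intro n
    have hn : (0 : ℝ) < 1 / (n + 1) := by positivity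
    rw [← net.lintegral_expNeg_tsum_power hCd hCr hd0 hα hn.le, ← lintegral_indicator_one hset]
    refine lintegral_mono fun ω => ?_
    simp_rw [ENNReal.ofReal_mul hn.le, ENNReal.tsum_mul_left]
    by_cases hω : S ω = ∞
    · rw [show ∑' k, ENNReal.ofReal (net.power Cd Cr d0 α k ω) = ∞ from hω, ENNReal.mul_top]
      · simp
      · simpa using hn
    · rw [Set.indicator_of_mem (show ω ∈ {ω | S ω ≠ ∞} from hω)]
      exact expNeg_le_one _
  have hlim : Tendsto (fun n : ℕ => ENNReal.ofReal
      (laplaceFactor lam p (e1 N Cd Cr d0 α) α (1 / (n + 1)) *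
        laplaceFactor lam (1 - p) Cd α (1 / (n + 1)))) atTop (𝓝 1) := by
    have h0 := tendsto_one_div_add_atTop_nhds_zero_nat (𝕜 := ℝ)
    have h1 := ((tendsto_laplaceFactor_zero lam p (e1 N Cd Cr d0 α) (by linarith : 0 < α)).comp
      h0).mul ((tendsto_laplaceFactor_zero lam (1 - p) Cd (by linarith : 0 < α)).comp h0)
    have h2 := (ENNReal.continuous_ofReal.tendsto _).comp h1
    simpa [Function.comp_def] using h2
  have hone : P {ω | S ω ≠ ∞} = 1 := le_antisymm prob_le_one (le_of_tendsto' hlim hbound)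
  have hae : ∀ᵐ ω ∂P, S ω ≠ ∞ := (prob_compl_eq_zero_iff hset).2 hone
  filter_upwards [hae] with ω hω
  refine (ENNReal.summable_toReal hω).congr fun k => ?_
  rw [ENNReal.toReal_ofReal (net.power_nonneg _ _ _ _ _ _)]

theorem isPalmExpectation_exp_neg_interference [IsProbabilityMeasure P]
    (net : RISNetwork P lam p N) {Cd Cr d0 α s : ℝ} (hCd : 0 < Cd) (hCr : 0 < Cr) (hd0 : 0 < d0)
    (hα : 2 < α) (hs : 0 ≤ s) :
    net.IsPalmExpectation
      (fun k ω => ENNReal.ofReal (Real.exp (-s * net.interference Cd Cr d0 α (some k) ω)))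
      (fun _ => ENNReal.ofReal
        (laplaceFactor lam p (e1 N Cd Cr d0 α) α s * laplaceFactor lam (1 - p) Cd α s)) := by
  refine ⟨measurable_const, fun B hB => ?_⟩
  set f : Plane → ℝ≥0∞ := fun x => negLog (markLaplace p N Cd Cr d0 α s x) with hf
  have hfm : Measurable f := measurable_negLog.comp (measurable_markLaplace p N Cd Cr d0 α s)
  have hftop : ∀ x, f x ≠ ∞ := fun x =>
    negLog_ne_top (markLaplace_le_one p N Cd Cr d0 α s x) (markLaplace_ne_zero p N Cd Cr d0 α s x)
  have htx := net.isHPPP_tx.measurable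
  -- The indicator that the serving point lies in `B` depends on the locations only, so for each
  -- fixed `k` the marks can be integrated out beside it; hence the sum over `k` is moved outside
  -- the integral and back.
  set W : ℕ → (ℕ → Plane) → ℝ≥0∞ := fun k x => B.indicator 1 (x k) with hW
  have hWm : ∀ k, Measurable (W k) := fun k =>
    (measurable_one.indicator hB).comp (measurable_pi_apply k)
  have hWtx : ∀ k, Measurable fun ω => W k (fun j => net.tx j ω) := fun k =>
    (hWm k).comp (measurable_pi_lambda _ htx)
  have hind : ∀ (k : ℕ) (c : ℝ≥0∞) (x : ℕ → Plane), B.indicator (fun _ => c) (x k) = W k x * c := by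
    intro k c x
    by_cases h : x k ∈ B <;> simp [hW, h]
  calc ∫⁻ ω, ∑' k, B.indicator (fun _ => ENNReal.ofReal
        (Real.exp (-s * net.interference Cd Cr d0 α (some k) ω))) (net.tx k ω) ∂P
      = ∫⁻ ω, ∑' k, W k (fun j => net.tx j ω) * expNeg (∑' j, if some k = some j then 0
          else ENNReal.ofReal (s * net.power Cd Cr d0 α j ω)) ∂P := by
        refine lintegral_congr_ae ?_
        filter_upwards [net.ae_summable_power hCd hCr hd0 hα] with ω hω
        congr 1 with k
        rw [hind k _ fun j => net.tx j ω, net.ofReal_exp_neg_mul_interference hs _ hω]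
    _ = ∑' k, ∫⁻ ω, W k (fun j => net.tx j ω) * expNeg (∑' j, if some k = some j then 0
          else ENNReal.ofReal (s * net.power Cd Cr d0 α j ω)) ∂P := by
        refine lintegral_tsum fun k => ((hWtx k).mul (measurable_expNeg.comp
          (Measurable.tsum fun j => ?_))).aemeasurable
        have := net.measurable_power Cd Cr d0 α j
        split_ifs <;> fun_prop
    _ = ∑' k, ∫⁻ ω, W k (fun j => net.tx j ω) * expNeg (∑' j, if some k = some j then 0
          else f (net.tx j ω)) ∂P := by
        congr 1 with k
        exact net.lintegral_mul_expNeg_tsum_power Cd Cr d0 α s (some k) (hWm k)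
    _ = ∫⁻ ω, ∑' k, B.indicator (fun _ => expNeg (∑' j, if j = k then 0
          else f (net.tx j ω))) (net.tx k ω) ∂P := by
        rw [← lintegral_tsum]
        · congr 1 with ω
          congr 1 with k
          rw [hind k _ fun j => net.tx j ω]
          simp only [Option.some.injEq, eq_comm]
        · refine fun k => ((hWtx k).mul (measurable_expNeg.comp
            (Measurable.tsum fun j => ?_))).aemeasurable
          split_ifs
          exacts [measurable_const, hfm.comp (htx j)]
    _ = lam * volume B * expNeg (lam * ∫⁻ x, (1 - expNeg (f x))) :=
        net.isHPPP_tx.lintegral_tsum_expNeg_of_measurableSet hfm hftop hB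
    _ = _ := by
        simp_rw [hf, expNeg_negLog (markLaplace_le_one p N Cd Cr d0 α s _)]
        rw [expNeg_mul_lintegral_one_sub_markLaplace p N lam hCd hCr hd0 hα hs, setLIntegral_const]
        ring

theorem integral_exp_neg_interference_none [IsProbabilityMeasure P]
    (net : RISNetwork P lam p N) {Cd Cr d0 α s : ℝ} (hCd : 0 < Cd) (hCr : 0 < Cr) (hd0 : 0 < d0)
    (hα : 2 < α) (hs : 0 ≤ s) :
    ∫ ω, Real.exp (-s * net.interference Cd Cr d0 α none ω) ∂P
      = laplaceFactor lam p (e1 N Cd Cr d0 α) α s * laplaceFactor lam (1 - p) Cd α s := by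
  have hae : (fun ω => Real.exp (-s * net.interference Cd Cr d0 α none ω)) =ᵐ[P]
      fun ω => (expNeg (∑' k, ENNReal.ofReal (s * net.power Cd Cr d0 α k ω))).toReal := by
    filter_upwards [net.ae_summable_power hCd hCr hd0 hα] with ω hω
    have h := net.ofReal_exp_neg_mul_interference hs none hω
    simp only [reduceCtorEq, if_false] at h
    rw [← h, ENNReal.toReal_ofReal (Real.exp_nonneg _)]
  have hm : Measurable fun ω => expNeg (∑' k, ENNReal.ofReal (s * net.power Cd Cr d0 α k ω)) :=
    measurable_expNeg.comp (Measurable.tsum fun k =>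
      ((net.measurable_power Cd Cr d0 α k).const_mul s).ennreal_ofReal)
  rw [integral_congr_ae hae, integral_toReal hm.aemeasurable
    (Eventually.of_forall fun ω => (expNeg_ne_top _).lt_top),
    net.lintegral_expNeg_tsum_power hCd hCr hd0 hα hs, ENNReal.toReal_ofReal]
  unfold laplaceFactor
  positivity

end RISNetwork

end

end

/-- The Laplace transform of the aggregate interference power under fixed association, both when the
serving TX is a TX of the network, conditioned to be at a fixed location `x`, and when it is a
further TX, put at a fixed location. -/
theorem proposition1 {Ω : Type*} [MeasurableSpace Ω] (P : Measure Ω) [IsProbabilityMeasure P]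
    (lam : ℝ≥0) (p : unitInterval) (N : ℕ) (Cd Cr d0 α : ℝ)
    (hlam : 0 < lam) (hCd : 0 < Cd) (hCr : 0 < Cr) (hd0 : 0 < d0) (hα : 2 < α)
    (net : RISNetwork P lam p N) :
    (∀ᵐ ω ∂P, Summable fun k => net.power Cd Cr d0 α k ω) ∧
    ∀ s : ℝ, 0 ≤ s →
      net.IsPalmExpectation
        (fun k ω => ENNReal.ofReal (Real.exp (-s * net.interference Cd Cr d0 α (some k) ω)))
        (fun _ => ENNReal.ofReal
          (laplaceFactor lam p (e1 N Cd Cr d0 α) α s * laplaceFactor lam (1 - p) Cd α s)) ∧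
      ∫ ω, Real.exp (-s * net.interference Cd Cr d0 α none ω) ∂P =
        laplaceFactor lam p (e1 N Cd Cr d0 α) α s * laplaceFactor lam (1 - p) Cd α s :=
  ⟨net.ae_summable_power hCd hCr hd0 hα, fun _ hs =>
    ⟨net.isPalmExpectation_exp_neg_interference hCd hCr hd0 hα hs,
      net.integral_exp_neg_interference_none hCd hCr hd0 hα hs⟩⟩
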